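/- **Setting.** Let $g:\mathcal X\to\mathcal A$ be a fixed measurable predictor, $L:\mathcal A\times\mathcal Y\to\mathbb R$ a measurable loss, $(X,Y)$ a random pair in $\mathcal X\times\mathcal Y$ (the deployment draw), and $Z=L(g(X),Y)$. For each $n$ let $D=\{(X_i,Y_i)\}_{i=1}^n$ be i.i.d. copies of $(X,Y)$, independent of $(X,Y)$, and $Z_i=L(g(X_i),Y_i)$. Split the indices $\{1,\dots,n\}$ into $I_1$ and $I_2$ (a deterministic split that may depend on $n$), with $n_1=|I_1|\to\infty$ and $n_2=|I_2|\to\infty$ as $n\to\infty$, and let $D_1,D_2$ be the corresponding parts of $D$. Let $\widetilde F_{n_1}(\cdot\mid x)$ be any predictive CDF fitted on $D_1$, that is, a family of CDFs on $\mathbb R$ that depends measurably on $(D_1,x)$. For $i\in I_2$ let $W_i=\widetilde F_{n_1}(Z_i\mid X_i)$. Fix $\alpha\in(0,1)$ and let $t_{1-\alpha}$ be the empirical $(1-\alpha)$-quantile of $\{W_i:i\in I_2\}$, in either of two conventions: $\inf\{w:\widehat H(w)\ge 1-\alpha\}$, where $\widehat H$ is the empirical CDF of the $W_i$; or the split-conformal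 quantile, i.e. the $k$-th smallest $W_i$ with $k=\lceil(1-\alpha)(n_2+1)\rceil$ if $k\le n_2$, and $1$ if $k=n_2+1$. Put $$U_\alpha(x)=\widetilde F_{n_1}^{-1}(t_{1-\alpha}\mid x),\qquad F^{-1}(p)=\inf\{z\in\mathbb R: F(z)\ge p\}\in[-\infty,+\infty].$$ Let $F_{Z\mid X}(\cdot\mid\cdot)$ be the CDF of a regular conditional distribution $\kappa$ of $Z$ given $X$ (any version), and let $x\in\mathcal X$ be fixed. **Assumptions.** (A1) $\sup_{z\in\mathbb R}|\widetilde F_{n_1}(z\mid X)-F_{Z\mid X}(z\mid X)|\to 0$ in probability (with respect to $D_1$ and the independent draw $X$). (A2) $\sup_{z\in\mathbb R}|\widetilde F_{n_1}(z\mid x)-F_{Z\mid X}(z\mid x)|\to0$ in probability (with respect to $D_1$). (A3) (i) $F_{Z\mid X}(\cdot\mid x')$ is continuous for $P_X$-almost every $x'$; (ii) $F_{Z\mid X}(\cdot\mid x)$ is continuous and its $(1-\alpha)$-quantile is unique, i.e. exactly one real $q$ satisfies $\kappa(x)((-\infty,q))\le 1-\alpha\le \kappa(x)((-\infty,q])$.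 **Theorem (asymptotic conditional coverage).** For every $n$, $\kappa$ is also a regular conditional distribution of $Z$ given $(X,D)$, so that $\mathbb P(Z\le u(D)\mid X=x,D)=\kappa(x)((-\infty,u(D)])$ for every measurable $u$ with values in $[-\infty,+\infty]$; and with this meaning of the left-hand side $$\mathbb P\bigl(Z\le U_\alpha(x)\mid X=x,\,D\bigr)\longrightarrow 1-\alpha\quad\text{in probability with respect to } D,\text{ as } n\to\infty .$$ Moreover $q_{1-\alpha}(x):=F_{Z\mid X}^{-1}(1-\alpha\mid x)$ is finite and $U_\alpha(x)\to q_{1-\alpha}(x)$ in probability. -/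

import Mathlib

open MeasureTheory ProbabilityTheory Filter Topology

noncomputable section

namespace LossCalibration

/-- Sup-distance `sup_z |F z - G z|` between two distribution functions (which take values in
`[0, 1]`, so that the supremum is over a bounded set). -/
def supDist (F G : ℝ → ℝ) : ℝ := ⨆ z : ℝ, |F z - G z|

/-- Generalized inverse `F⁻¹(p) = inf {z ∈ ℝ : p ≤ F z}`, with values in `[-∞, +∞]`
(the infimum of the empty set is `+∞`). -/
def genInv (F : ℝ → ℝ) (p : ℝ) : EReal := ⨅ z ∈ {z : ℝ | p ≤ F z}, (z : EReal)

/-- `q` is a quantile of level `p` of the law `ν` on the real line: `ν(-∞, q) ≤ p ≤ ν(-∞, q]`. -/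
def IsQuantile (ν : Measure ℝ) (p q : ℝ) : Prop :=
  ν.real (Set.Iio q) ≤ p ∧ p ≤ ν.real (Set.Iic q)

/-- Empirical distribution function of the values `W i`, `i ∈ s`. -/
def empCDF {ι : Type*} (s : Finset ι) (W : ι → ℝ) (w : ℝ) : ℝ :=
  ({i ∈ s | W i ≤ w}.card : ℝ) / (s.card : ℝ)

/-- The `k`-th smallest of the values `W i`, `i ∈ s`, for `1 ≤ k ≤ |s|`. -/
def orderStat {ι : Type*} (s : Finset ι) (W : ι → ℝ) (k : ℕ) : ℝ :=
  sInf {w : ℝ | k ≤ {i ∈ s | W i ≤ w}.card}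

/-- The two usual conventions for the empirical `(1 - α)`-quantile of a calibration sample. -/
inductive QuantileConvention
  /-- the left-continuous inverse of the empirical distribution function -/
  | plain
  /-- the split-conformal quantile: the `⌈(1 - α)(m + 1)⌉`-th smallest of the `m` values, and `1`
  if this rank is `m + 1` -/
  | splitConformal

/-- The calibrated level `t_{1-α}`: the empirical `(1 - α)`-quantile of the PIT values
`W i`, `i ∈ s`. -/
def calibratedLevel (c : QuantileConvention) {ι : Type*} (s : Finset ι) (W : ι → ℝ) (α : ℝ) : ℝ :=
  match c with
  | .plain => sInf {w : ℝ | 1 - α ≤ empCDF s W w}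
  | .splitConformal =>
      if ⌈(1 - α) * ((s.card : ℝ) + 1)⌉₊ ≤ s.card then
        orderStat s W ⌈(1 - α) * ((s.card : ℝ) + 1)⌉₊
      else 1

variable {𝒳 𝒴 𝒜 : Type*} [MeasurableSpace 𝒳] [MeasurableSpace 𝒴]

/-- The subsample of the data set `d` with indices in `I`. -/
def subsample {n : ℕ} (I : Finset (Fin n)) (d : Fin n → 𝒳 × 𝒴) : I → 𝒳 × 𝒴 := fun i => d i

/-- The predictive CDF `z ↦ F̃(z | x)` of the loss, fitted on the subsample `D₁` of the data set `d`
with indices in `I₁`. The fitting rule `Ftilde` is a (measurable) map that sends the pair `(D₁, x)`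
to a probability law on the real line. -/
def predCDF {n : ℕ} {I₁ : Finset (Fin n)} (Ftilde : Kernel ((I₁ → 𝒳 × 𝒴) × 𝒳) ℝ)
    (d : Fin n → 𝒳 × 𝒴) (x : 𝒳) : ℝ → ℝ :=
  fun z => cdf (Ftilde (subsample I₁ d, x)) z

/-- The PIT values `W i = F̃(Z i | X i)`, where `Z i = L (g (X i)) (Y i)`. -/
def pit (g : 𝒳 → 𝒜) (L : 𝒜 → 𝒴 → ℝ) {n : ℕ} {I₁ : Finset (Fin n)}
    (Ftilde : Kernel ((I₁ → 𝒳 × 𝒴) × 𝒳) ℝ) (d : Fin n → 𝒳 × 𝒴) (i : Fin n) : ℝ :=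
  predCDF Ftilde d (d i).1 (L (g (d i).1) (d i).2)

/-- The calibrated upper loss bound `U_α(x) = F̃⁻¹(t_{1-α} | x)`, where `F̃` is fitted on the points
with indices in `I₁` and `t_{1-α}` is the empirical `(1 - α)`-quantile of the PIT values of the
remaining points. -/
def upperBound (c : QuantileConvention) (g : 𝒳 → 𝒜) (L : 𝒜 → 𝒴 → ℝ) (α : ℝ) {n : ℕ}
    {I₁ : Finset (Fin n)} (Ftilde : Kernel ((I₁ → 𝒳 × 𝒴) × 𝒳) ℝ)
    (d : Fin n → 𝒳 × 𝒴) (x : 𝒳) : EReal :=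
  genInv (predCDF Ftilde d x) (calibratedLevel c I₁ᶜ (pit g L Ftilde d) α)

end LossCalibration

end

/-! With the true conditional CDF in place of the fitted one, the PIT values `G (X i, Z i)` would be
i.i.d. uniform, so Chebyshev pins their empirical CDF at two levels near `1 - α`. The fitted values
`W i` differ from these by at most `δ`, except at indices where the fitted CDF is bad. A held-out
point is independent of `D₁`, so it is bad with the same probability as the deployment draw; (A1)
and Markov make the bad fraction small. Hence the calibrated level tends to `1 - α` in probability
(`tendsto_measure_calibratedLevel_notMem`). At the target `x`, (A2) transfers this to `U_α(x)`: it
falls between any `a`, `b` with `F(a | x) < 1 - α < F(b | x)` (`tendsto_measure_upperBound_notMem`).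
Uniqueness of the quantile puts such `a`, `b` arbitrarily close to `q`, and continuity at `q` turns
this into coverage. -/

namespace LossCalibration

/-! ### Distribution functions and generalized inverses -/

section CDF

/-- Probability integral transform. The sublevel set contains `Iic z` when `F z = s` and lies inside
`Iic z` when `F z = r > s`; letting `r` decrease to `s` avoids selecting the largest point of a
level set. -/
theorem measureReal_cdf_le (ν : Measure ℝ) [IsProbabilityMeasure ν] (hν : Continuous (cdf ν))
    {s : ℝ} (hs : s ∈ Set.Ioo (0 : ℝ) 1) : ν.real {z | cdf ν z ≤ s} = s := by
  have surj : ∀ r ∈ Set.Ioo (0 : ℝ) 1, ∃ z, cdf ν z = r := by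
    intro r hr
    obtain ⟨a, ha⟩ := ((tendsto_cdf_atBot ν).eventually (gt_mem_nhds hr.1)).exists
    obtain ⟨b, hb⟩ := ((tendsto_cdf_atTop ν).eventually (lt_mem_nhds hr.2)).exists
    exact mem_range_of_exists_le_of_exists_ge hν ⟨a, ha.le⟩ ⟨b, hb.le⟩
  apply le_antisymm
  · refine le_of_forall_gt_imp_ge_of_dense fun r hr => ?_
    rcases lt_or_ge r 1 with h1 | h1
    · obtain ⟨z, hz⟩ := surj r ⟨hs.1.trans hr, h1⟩
      rw [← hz, cdf_eq_real]
      refine measureReal_mono fun y hy => ?_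
      by_contra hlt
      have := monotone_cdf ν (not_le.1 hlt).le
      simp only [Set.mem_ofPred_eq] at hy
      linarith
    · exact measureReal_le_one.trans h1
  · obtain ⟨z, hz⟩ := surj s hs
    conv_lhs => rw [← hz, cdf_eq_real]
    exact measureReal_mono fun y hy => (monotone_cdf ν hy).trans hz.le

theorem abs_cdf_sub_le_one (μ ν : Measure ℝ) (z : ℝ) : |cdf μ z - cdf ν z| ≤ 1 := by
  rw [abs_le]
  constructor <;> linarith [cdf_nonneg μ z, cdf_le_one μ z, cdf_nonneg ν z, cdf_le_one ν z]

theorem abs_cdf_sub_le_supDist (μ ν : Measure ℝ) (z : ℝ) :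
    |cdf μ z - cdf ν z| ≤ supDist (cdf μ) (cdf ν) :=
  le_ciSup (f := fun z => |cdf μ z - cdf ν z|)
    ⟨1, by rintro _ ⟨z, rfl⟩; exact abs_cdf_sub_le_one μ ν z⟩ z

/-- Right-continuity reduces the supremum to rational points, which makes the sup-distance
measurable. -/
theorem lt_supDist_cdf_iff (μ ν : Measure ℝ) (δ : ℝ) :
    δ < supDist (cdf μ) (cdf ν) ↔ ∃ r : ℚ, δ < |cdf μ r - cdf ν r| := by
  constructor
  · intro h
    obtain ⟨z, hz⟩ := exists_lt_of_lt_ciSup h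
    have hc : ContinuousWithinAt (fun z => |cdf μ z - cdf ν z|) (Set.Ioi z) z :=
      ((((cdf μ).right_continuous z).sub ((cdf ν).right_continuous z)).mono
        Set.Ioi_subset_Ici_self).abs
    obtain ⟨u, hu, hu'⟩ := (mem_nhdsGT_iff_exists_Ioo_subset).1 (hc.eventually (lt_mem_nhds hz))
    obtain ⟨r, hr⟩ := exists_rat_btwn (Set.mem_Ioi.1 hu)
    exact ⟨r, hu' hr⟩
  · rintro ⟨r, hr⟩
    exact hr.trans_le (abs_cdf_sub_le_supDist μ ν r)

theorem le_genInv {F : ℝ → ℝ} (hF : Monotone F) {a t : ℝ} (h : F a < t) :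
    (a : EReal) ≤ genInv F t := by
  refine le_iInf₂ fun z hz => ?_
  rw [EReal.coe_le_coe_iff]
  by_contra hlt
  exact absurd (hF (not_le.1 hlt).le) (not_le.2 (h.trans_le hz))

theorem genInv_le {F : ℝ → ℝ} {b t : ℝ} (h : t ≤ F b) : genInv F t ≤ (b : EReal) :=
  iInf₂_le b h

/-- Continuity excludes atoms, so quantiles are exactly the solutions of `F r = p`; uniqueness then
rules out a flat stretch at height `p`. -/
theorem cdf_lt_and_lt_cdf_of_unique (ν : Measure ℝ) [IsProbabilityMeasure ν]
    (hν : Continuous (cdf ν)) {p q : ℝ} (hq : IsQuantile ν p q)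
    (huniq : ∀ r, IsQuantile ν p r → r = q) :
    cdf ν q = p ∧ (∀ r < q, cdf ν r < p) ∧ ∀ r, q < r → p < cdf ν r := by
  have hIio : ∀ r, ν.real (Set.Iio r) = cdf ν r := by
    intro r
    have h0 : ν {r} = 0 := by
      conv_lhs => rw [← measure_cdf ν]
      rw [StieltjesFunction.measure_singleton, hν.continuousAt.continuousWithinAt.leftLim_eq]
      simp
    rw [cdf_eq_real, measureReal_def, measureReal_def, ← Set.Iio_union_right]
    congr 1
    refine le_antisymm (measure_mono Set.subset_union_left) ((measure_union_le _ _).trans ?_)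
    simp [h0]
  have hiff : ∀ r, IsQuantile ν p r ↔ cdf ν r = p := by
    intro r
    rw [IsQuantile, hIio, ← cdf_eq_real, le_antisymm_iff]
  rw [hiff] at hq
  refine ⟨hq, fun r hr => ?_, fun r hr => ?_⟩
  · refine lt_of_le_of_ne (hq ▸ monotone_cdf ν hr.le) fun h => ?_
    exact hr.ne (huniq r ((hiff r).2 h))
  · refine lt_of_le_of_ne (hq ▸ monotone_cdf ν hr.le) fun h => ?_
    exact hr.ne' (huniq r ((hiff r).2 h.symm))

end CDF

/-! ### Deterministic bounds for empirical quantiles -/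

section Empirical

variable {ι : Type*}

theorem empCDF_mono (s : Finset ι) (W : ι → ℝ) : Monotone (empCDF s W) := by
  intro a b hab
  unfold empCDF
  gcongr

theorem empCDF_le_add (s : Finset ι) {W V : ι → ℝ} {B : ι → Prop} [DecidablePred B] {a b : ℝ}
    (h : ∀ i ∈ s, W i ≤ a → V i ≤ b ∨ B i) :
    empCDF s W a ≤ empCDF s V b + ({i ∈ s | B i}.card : ℝ) / s.card := by
  classical
  unfold empCDF
  rw [← add_div]
  gcongr
  norm_cast
  refine le_trans (Finset.card_le_card ?_) (Finset.card_union_le _ _)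
  intro i hi
  simp only [Finset.mem_filter, Finset.mem_union] at hi ⊢
  rcases h i hi.1 hi.2 with h' | h'
  · exact Or.inl ⟨hi.1, h'⟩
  · exact Or.inr ⟨hi.1, h'⟩

/-- The slack `η` absorbs the `m + 1` in the conformal rank, so one bracket serves both conventions.
-/
theorem calibratedLevel_mem_Icc (c : QuantileConvention) (s : Finset ι) (W : ι → ℝ) {α a b η : ℝ}
    (hα : α ∈ Set.Ioo (0 : ℝ) 1) (hs : 1 ≤ η * s.card) (hs0 : 0 < s.card)
    (ha : empCDF s W a < 1 - α) (hb : 1 - α + η ≤ empCDF s W b) :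
    calibratedLevel c s W α ∈ Set.Icc a b := by
  have hm : (0 : ℝ) < s.card := by exact_mod_cast hs0
  have hη : 0 < η := by
    by_contra h
    nlinarith
  -- `a` bounds `S` below and `b` makes it nonempty, so `sInf` is a genuine infimum.
  have key : ∀ S : Set ℝ, (∀ w ∈ S, 1 - α ≤ empCDF s W w) → b ∈ S → sInf S ∈ Set.Icc a b := by
    intro S hS hbS
    have hlb : ∀ w ∈ S, a ≤ w := by
      intro w hw
      by_contra h
      linarith [hS w hw, empCDF_mono s W (not_le.1 h).le]
    exact ⟨le_csInf ⟨b, hbS⟩ hlb, csInf_le ⟨a, hlb⟩ hbS⟩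
  cases c with
  | plain => exact key _ (fun w hw => hw) (by simp only [Set.mem_ofPred_eq]; linarith)
  | splitConformal =>
    -- The excess `1 - α` of the rank over `(1 - α) m` is at most `1 ≤ η m`. This also forces rank
    -- `≤ m`, so the default value `1` does not occur.
    have hcount : ⌈(1 - α) * ((s.card : ℝ) + 1)⌉₊ ≤ {i ∈ s | W i ≤ b}.card := by
      rw [Nat.ceil_le]
      unfold empCDF at hb
      rw [le_div_iff₀ hm] at hb
      nlinarith [hα.1]
    have hle := hcount.trans (Finset.card_filter_le s _)
    simp only [calibratedLevel, hle, if_true, orderStat]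
    refine key _ (fun w hw => ?_) hcount
    have hw' : (1 - α) * ((s.card : ℝ) + 1) ≤ ({i ∈ s | W i ≤ w}.card : ℝ) := Nat.ceil_le.1 hw
    unfold empCDF
    rw [le_div_iff₀ hm]
    nlinarith [hα.2]

end Empirical

end LossCalibration

namespace LossCalibration

/-! ### Concentration, measurability and conditional laws -/

section Probability

variable {Ω β ι 𝒳 : Type*} [MeasurableSpace Ω] [MeasurableSpace β] [MeasurableSpace 𝒳]

/-- Chebyshev, with variance at most `1/4` for each indicator. -/
theorem measure_frequency_deviation_le (P : Measure Ω) [IsProbabilityMeasure P] (s : Finset ι)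
    (hs : s.Nonempty) {ξ : ι → Ω → β} (hind : iIndepFun ξ P) (hξ : ∀ i, AEMeasurable (ξ i) P)
    {B : Set β} [DecidablePred (· ∈ B)] (hB : MeasurableSet B) {p : ℝ}
    (hp : ∀ i ∈ s, P.real (ξ i ⁻¹' B) = p) {δ : ℝ} (hδ : 0 < δ) :
    P {ω | δ ≤ |({i ∈ s | ξ i ω ∈ B}.card : ℝ) / s.card - p|} ≤
      ENNReal.ofReal (1 / (4 * δ ^ 2) / s.card) := by
  have hm : (0 : ℝ) < s.card := by exact_mod_cast hs.card_pos
  set f : β → ℝ := fun b => if b ∈ B then 1 else 0 with hf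
  have hfm : Measurable f := Measurable.ite hB measurable_const measurable_const
  have hf01 : ∀ b, f b ∈ Set.Icc (0 : ℝ) 1 := by
    intro b
    simp only [hf]
    split_ifs <;> simp
  have hXm : ∀ i, AEMeasurable (f ∘ ξ i) P := fun i => hfm.comp_aemeasurable (hξ i)
  have hL2 : ∀ i, MemLp (f ∘ ξ i) 2 P := fun i =>
    memLp_of_bounded (a := 0) (b := 1) (ae_of_all _ fun ω => hf01 _)
      (hXm i).aestronglyMeasurable 2
  have hint : ∀ i ∈ s, ∫ ω, (f ∘ ξ i) ω ∂P = p := by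
    intro i hi
    have hE : NullMeasurableSet (ξ i ⁻¹' B) P := (hξ i).nullMeasurableSet_preimage hB
    have : (f ∘ ξ i) = (ξ i ⁻¹' B).indicator 1 := by
      ext ω
      by_cases h : ξ i ω ∈ B <;> simp [hf, h]
    rw [this, integral_indicator₀ hE]
    simp [hp i hi]
  have hvar : variance (∑ i ∈ s, f ∘ ξ i) P ≤ s.card * (1 / 4) := by
    rw [IndepFun.variance_sum (fun i _ => hL2 i)
      (fun i _ j _ hij => (hind.indepFun hij).comp hfm hfm)]
    rw [← nsmul_eq_mul]
    refine Finset.sum_le_card_nsmul _ _ _ fun i _ => ?_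
    refine (variance_le_sq_of_bounded (a := 0) (b := 1) (ae_of_all _ fun ω => hf01 _)
      (hXm i)).trans (by norm_num)
  have hexp : ∫ ω, (∑ i ∈ s, f ∘ ξ i) ω ∂P = s.card * p := by
    simp only [Finset.sum_apply]
    rw [integral_finsetSum _ fun i _ => (hL2 i).integrable (by norm_num),
      Finset.sum_congr rfl hint]
    simp
  have hsum : ∀ ω, (∑ i ∈ s, f ∘ ξ i) ω = ({i ∈ s | ξ i ω ∈ B}.card : ℝ) := by
    intro ω
    simp [hf]
  have hcheb := meas_ge_le_variance_div_sq (μ := P)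
    (memLp_finsetSum' s fun i _ => hL2 i) (mul_pos hm hδ)
  refine (measure_mono fun ω hω => ?_).trans (hcheb.trans (ENNReal.ofReal_le_ofReal ?_))
  · simp only [Set.mem_ofPred_eq] at hω ⊢
    rw [hexp, hsum]
    have : ({i ∈ s | ξ i ω ∈ B}.card : ℝ) - s.card * p =
        s.card * (({i ∈ s | ξ i ω ∈ B}.card : ℝ) / s.card - p) := by
      field_simp
    rw [this, abs_mul, abs_of_pos hm]
    gcongr
  · rw [div_le_iff₀ (by positivity)]
    refine hvar.trans (le_of_eq ?_)
    field_simp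

/-- Markov applied to the count. No independence is required, which matters because the bad events
all involve the same `D₁`. -/
theorem measure_frequency_ge_le (P : Measure Ω) (s : Finset ι) (hs : s.Nonempty)
    {E : ι → Ω → Prop} [∀ ω, DecidablePred (E · ω)]
    (hE : ∀ i, i ∈ s → NullMeasurableSet {ω | E i ω} P)
    {p : ENNReal} (hp : ∀ i ∈ s, P {ω | E i ω} ≤ p) {δ : ℝ} (hδ : 0 < δ) :
    P {ω | δ ≤ ({i ∈ s | E i ω}.card : ℝ) / s.card} ≤ p / ENNReal.ofReal δ := by
  have hm : (0 : ℝ) < s.card := by exact_mod_cast hs.card_pos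
  set G : Ω → ENNReal := fun ω => ∑ i ∈ s, {ω | E i ω}.indicator 1 ω with hG
  have hGm : AEMeasurable G P :=
    Finset.aemeasurable_fun_sum s fun i hi => aemeasurable_one.indicator₀ (hE i hi)
  have hGc : ∀ ω, G ω = ({i ∈ s | E i ω}.card : ENNReal) := by
    intro ω
    simp [hG, Set.indicator_apply]
  have hGi : ∫⁻ ω, G ω ∂P ≤ s.card * p := by
    rw [hG, lintegral_finsetSum' s (f := fun i => {ω | E i ω}.indicator (1 : Ω → ENNReal))
      fun i hi => aemeasurable_one.indicator₀ (hE i hi), ← nsmul_eq_mul]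
    refine Finset.sum_le_card_nsmul _ _ _ fun i hi => ?_
    rw [lintegral_indicator_one₀ (hE i hi)]
    exact hp i hi
  have hmk := mul_meas_ge_le_lintegral₀ hGm (s.card * ENNReal.ofReal δ)
  have hs0 : (s.card : ENNReal) ≠ 0 := by exact_mod_cast hs.card_pos.ne'
  have hs1 : (s.card : ENNReal) ≠ ⊤ := ENNReal.natCast_ne_top _
  rw [ENNReal.le_div_iff_mul_le (Or.inl (by simpa using hδ)) (Or.inl ENNReal.ofReal_ne_top)]
  have h1 : (s.card : ENNReal) * (ENNReal.ofReal δ *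
      P {ω | (s.card : ENNReal) * ENNReal.ofReal δ ≤ G ω}) ≤ s.card * p := by
    rw [← mul_assoc]
    exact hmk.trans hGi
  rw [ENNReal.mul_le_mul_iff_right hs0 hs1] at h1
  rw [mul_comm]
  refine le_trans ?_ h1
  gcongr with ω
  intro hω
  rw [hGc, ← ENNReal.ofReal_natCast, ← ENNReal.ofReal_natCast, ← ENNReal.ofReal_mul hm.le]
  apply ENNReal.ofReal_le_ofReal
  rw [le_div_iff₀ hm] at hω
  linarith

theorem measurable_cdf_kernel (κ : Kernel 𝒳 ℝ) [IsMarkovKernel κ] :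
    Measurable fun a : 𝒳 × ℝ => cdf (κ a.1) a.2 := by
  have h := Kernel.measurable_kernel_prodMk_left (κ := κ.prodMkRight ℝ)
    (t := {b : (𝒳 × ℝ) × ℝ | b.2 ≤ b.1.2}) (measurableSet_le (by fun_prop) (by fun_prop))
  have h2 := h.ennreal_toReal
  convert! h2 using 2 with a
  rw [cdf_eq_real, measureReal_def, Kernel.prodMkRight_apply]
  rfl

theorem measurableSet_lt_supDist (κ η : Kernel 𝒳 ℝ) [IsMarkovKernel κ] [IsMarkovKernel η]
    (δ : ℝ) : MeasurableSet {a | δ < supDist (cdf (κ a)) (cdf (η a))} := by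
  simp only [lt_supDist_cdf_iff, Set.ofPred_exists]
  refine MeasurableSet.iUnion fun r => measurableSet_lt measurable_const ?_
  have h1 : Measurable fun a => cdf (κ a) (r : ℝ) :=
    (measurable_cdf_kernel κ).comp (measurable_id.prodMk measurable_const)
  have h2 : Measurable fun a => cdf (η a) (r : ℝ) :=
    (measurable_cdf_kernel η).comp (measurable_id.prodMk measurable_const)
  exact (h1.sub h2).abs

/-- Disintegrating over `X` reduces this to the probability integral transform in almost every
fibre. -/
theorem measureReal_conditional_cdf_le {P : Measure Ω} [IsProbabilityMeasure P]
    {X : Ω → 𝒳} {Z : Ω → ℝ} {κ : Kernel 𝒳 ℝ} [IsMarkovKernel κ] (h : HasCondDistrib Z X κ P)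
    (hc : ∀ᵐ x ∂(P.map X), Continuous (cdf (κ x))) {s : ℝ} (hs : s ∈ Set.Ioo (0 : ℝ) 1) :
    P.real {ω | cdf (κ (X ω)) (Z ω) ≤ s} = s := by
  have hX := h.aemeasurable_fst
  have : IsProbabilityMeasure (P.map X) := Measure.isProbabilityMeasure_map hX
  have hm : MeasurableSet {a : 𝒳 × ℝ | cdf (κ a.1) a.2 ≤ s} :=
    measurableSet_le (measurable_cdf_kernel κ) measurable_const
  have h1 : P {ω | cdf (κ (X ω)) (Z ω) ≤ s} = ENNReal.ofReal s := by
    have : {ω | cdf (κ (X ω)) (Z ω) ≤ s} =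
      (fun ω => (X ω, Z ω)) ⁻¹' {a : 𝒳 × ℝ | cdf (κ a.1) a.2 ≤ s} := rfl
    rw [this, ← Measure.map_apply_of_aemeasurable h.aemeasurable hm, h.map_eq,
      Measure.compProd_apply hm]
    calc _ = ∫⁻ _, ENNReal.ofReal s ∂(P.map X) := by
          refine lintegral_congr_ae (hc.mono fun x hx => ?_)
          have := measureReal_cdf_le (κ x) hx hs
          change κ x {z | cdf (κ x) z ≤ s} = _
          rw [← ENNReal.ofReal_toReal (measure_ne_top (κ x) _), ← measureReal_def, this]
      _ = _ := by simp
  rw [measureReal_def, h1, ENNReal.toReal_ofReal hs.1.le]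

/-- It suffices to compare the two laws on boxes `(s ×ˢ t) ×ˢ u`, where independence splits off the
factor `P (D ∈ t)`. -/
theorem hasCondDistrib_prodMkRight_of_indepFun {γ : Type*} [MeasurableSpace γ] {P : Measure Ω}
    [IsProbabilityMeasure P] {X : Ω → 𝒳} {Z : Ω → β} {D : Ω → γ} {κ : Kernel 𝒳 β}
    [IsMarkovKernel κ] (h : HasCondDistrib Z X κ P) (hD : AEMeasurable D P)
    (hind : IndepFun (fun ω => (X ω, Z ω)) D P) :
    HasCondDistrib Z (fun ω => (X ω, D ω)) (κ.prodMkRight γ) P := by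
  have hX := h.aemeasurable_fst
  have hZ := h.aemeasurable_snd
  have hXD : IndepFun X D P := hind.comp measurable_fst measurable_id
  have hPX : IsProbabilityMeasure (P.map X) := Measure.isProbabilityMeasure_map hX
  have hPD : IsProbabilityMeasure (P.map D) := Measure.isProbabilityMeasure_map hD
  have hP : IsProbabilityMeasure (P.map fun ω => ((X ω, D ω), Z ω)) :=
    Measure.isProbabilityMeasure_map ((hX.prodMk hD).prodMk hZ)
  refine ⟨(hX.prodMk hD).prodMk hZ, ?_⟩
  refine Measure.ext_prod₃' fun {s t u} hs ht hu => ?_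
  have hXZ : P (X ⁻¹' s ∩ Z ⁻¹' u) = ∫⁻ x in s, κ x u ∂(P.map X) := by
    rw [← Measure.compProd_apply_prod hs hu, ← h.map_eq,
      Measure.map_apply_of_aemeasurable (hX.prodMk hZ) (hs.prod hu)]
    rfl
  have hsplit : (fun ω => ((X ω, D ω), Z ω)) ⁻¹' ((s ×ˢ t) ×ˢ u) =
      (fun ω => (X ω, Z ω)) ⁻¹' (s ×ˢ u) ∩ D ⁻¹' t := by
    ext ω
    simp only [Set.mem_preimage, Set.mem_prod, Set.mem_inter_iff]
    tauto
  rw [Measure.map_apply_of_aemeasurable ((hX.prodMk hD).prodMk hZ) ((hs.prod ht).prod hu),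
    hsplit, hind.measure_inter_preimage_eq_mul _ _ (hs.prod hu) ht,
    Measure.compProd_apply_prod (hs.prod ht) hu, hXD.map_prod_eq_prod_map_map hX hD,
    ← Measure.prod_restrict]
  have hfac := lintegral_prod_mul (μ := (P.map X).restrict s) (ν := (P.map D).restrict t)
    (f := fun x => κ x u) (g := fun _ => 1) (κ.measurable_coe hu).aemeasurable aemeasurable_const
  simp only [mul_one, lintegral_const, one_mul, Measure.restrict_apply MeasurableSet.univ,
    Set.univ_inter] at hfac
  simp only [Kernel.prodMkRight_apply]
  rw [hfac, ← hXZ, Measure.map_apply_of_aemeasurable hD ht]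
  rfl

end Probability

end LossCalibration

namespace LossCalibration

/-! ### Consistency of the calibrated level and of the bound -/

section Calibration

variable {Ω 𝒳 𝒴 𝒜 : Type*} [MeasurableSpace Ω] [MeasurableSpace 𝒳] [MeasurableSpace 𝒴]

/-- The fitted CDF at a held-out design point is as close to the truth as at the deployment
point. -/
theorem measure_lt_supDist_heldOut {P : Measure Ω} [IsProbabilityMeasure P]
    {X : Ω → 𝒳} {Y : Ω → 𝒴} {n : ℕ} {D : Ω → Fin n → 𝒳 × 𝒴}
    (hindep : iIndepFun (fun i ω => D ω i) P)
    (hident : ∀ i, IdentDistrib (fun ω => D ω i) (fun ω => (X ω, Y ω)) P P)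
    (hdeploy : IndepFun (fun ω => (X ω, Y ω)) D P) {I : Finset (Fin n)}
    (F : Kernel ((I → 𝒳 × 𝒴) × 𝒳) ℝ) [IsMarkovKernel F] (κ : Kernel 𝒳 ℝ) [IsMarkovKernel κ]
    (δ : ℝ) {i : Fin n} (hi : i ∈ Iᶜ) :
    NullMeasurableSet {ω | δ < supDist (predCDF F (D ω) (D ω i).1) (cdf (κ (D ω i).1))} P ∧
    P {ω | δ < supDist (predCDF F (D ω) (D ω i).1) (cdf (κ (D ω i).1))} =
      P {ω | δ < supDist (predCDF F (D ω) (X ω)) (cdf (κ (X ω)))} := by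
  set T : Set ((I → 𝒳 × 𝒴) × 𝒳) := {a | δ < supDist (cdf (F a)) (cdf (κ a.2))} with hT
  have hTm : MeasurableSet T :=
    measurableSet_lt_supDist F (κ.comap Prod.snd measurable_snd) δ
  have hDm : ∀ j, AEMeasurable (fun ω => D ω j) P := fun j => (hident j).aemeasurable_fst
  have hS : AEMeasurable (fun ω => subsample I (D ω)) P :=
    aemeasurable_pi_lambda _ fun j => hDm j
  have hXY : AEMeasurable (fun ω => (X ω, Y ω)) P := (hident i).aemeasurable_snd
  have hi1 : AEMeasurable (fun ω => (D ω i).1) P := (hDm i).fst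
  have hind1 : IndepFun (fun ω => subsample I (D ω)) (fun ω => (D ω i).1) P := by
    have := hindep.indepFun_finset₀ I {i}
      (Finset.disjoint_singleton_right.2 (Finset.mem_compl.1 hi)) hDm
    exact this.comp (φ := id) (ψ := fun f => (f ⟨i, Finset.mem_singleton_self i⟩).1)
      measurable_id (by fun_prop)
  have hsub : Measurable (subsample I : (Fin n → 𝒳 × 𝒴) → _) :=
    measurable_pi_lambda _ fun j => measurable_pi_apply _
  have hind2 : IndepFun (fun ω => subsample I (D ω)) X P :=
    (hdeploy.comp measurable_fst hsub).symm
  -- Both sides are the product of the law of `D₁` and the law of `X`.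
  have hmap : P.map (fun ω => (subsample I (D ω), (D ω i).1)) =
      P.map (fun ω => (subsample I (D ω), X ω)) := by
    rw [hind1.map_prod_eq_prod_map_map hS hi1, hind2.map_prod_eq_prod_map_map hS hXY.fst]
    congr 1
    exact ((hident i).comp measurable_fst).map_eq
  refine ⟨(hS.prodMk hi1).nullMeasurableSet_preimage hTm, ?_⟩
  have := DFunLike.congr_fun hmap T
  rwa [Measure.map_apply_of_aemeasurable (hS.prodMk hi1) hTm,
    Measure.map_apply_of_aemeasurable (hS.prodMk hXY.fst) hTm] at this

theorem tendsto_measure_calibratedLevel_notMem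
    {P : Measure Ω} [IsProbabilityMeasure P] [MeasurableSpace 𝒜]
    {g : 𝒳 → 𝒜} (hg : Measurable g) {L : 𝒜 → 𝒴 → ℝ} (hL : Measurable (Function.uncurry L))
    {X : Ω → 𝒳} {Y : Ω → 𝒴} {D : (n : ℕ) → Ω → Fin n → 𝒳 × 𝒴}
    (hD_indep : ∀ n, iIndepFun (fun (i : Fin n) (ω : Ω) => D n ω i) P)
    (hD_ident : ∀ n (i : Fin n), IdentDistrib (fun ω => D n ω i) (fun ω => (X ω, Y ω)) P P)
    (hD_deploy : ∀ n, IndepFun (fun ω => (X ω, Y ω)) (D n) P)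
    {I₁ : (n : ℕ) → Finset (Fin n)}
    (hn₂ : Tendsto (fun n => (I₁ n)ᶜ.card) atTop atTop)
    {Ftilde : (n : ℕ) → Kernel ((I₁ n → 𝒳 × 𝒴) × 𝒳) ℝ} [∀ n, IsMarkovKernel (Ftilde n)]
    {κ : Kernel 𝒳 ℝ} [IsMarkovKernel κ]
    (hκ : HasCondDistrib (fun ω => L (g (X ω)) (Y ω)) X κ P)
    {α : ℝ} (hα : α ∈ Set.Ioo (0 : ℝ) 1)
    (hA1 : TendstoInMeasure P
      (fun n ω => supDist (predCDF (Ftilde n) (D n ω) (X ω)) (cdf (κ (X ω)))) atTop (fun _ => 0))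
    (hcont : ∀ᵐ x ∂(P.map X), Continuous (cdf (κ x)))
    (c : QuantileConvention) {δ : ℝ} (hδ : 0 < δ) (hδα : 4 * δ < α) (hδα' : 4 * δ < 1 - α) :
    Tendsto (fun n => P {ω | calibratedLevel c (I₁ n)ᶜ (pit g L (Ftilde n) (D n ω)) α ∉
      Set.Icc (1 - α - 4 * δ) (1 - α + 4 * δ)}) atTop (𝓝 0) := by
  classical
  set G : 𝒳 × 𝒴 → ℝ := fun b => cdf (κ b.1) (L (g b.1) b.2) with hG
  have hGm : Measurable G := (measurable_cdf_kernel κ).comp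
    (measurable_fst.prodMk (hL.comp ((hg.comp measurable_fst).prodMk measurable_snd)))
  set p : ℕ → ENNReal := fun n =>
    P {ω | δ ≤ ‖supDist (predCDF (Ftilde n) (D n ω) (X ω)) (cdf (κ (X ω))) - 0‖} with hp
  have hp0 : Tendsto p atTop (𝓝 0) := (tendstoInMeasure_iff_norm.1 hA1) δ hδ
  have hfreq : ∀ n, (I₁ n)ᶜ.Nonempty → ∀ s ∈ Set.Ioo (0 : ℝ) 1,
      P {ω | δ ≤ |empCDF (I₁ n)ᶜ (fun i => G (D n ω i)) s - s|} ≤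
        ENNReal.ofReal (1 / (4 * δ ^ 2) / (I₁ n)ᶜ.card) := by
    intro n hn s hs
    have hB : MeasurableSet {b | G b ≤ s} := measurableSet_le hGm measurable_const
    refine measure_frequency_deviation_le P (I₁ n)ᶜ hn (hD_indep n)
      (fun i => (hD_ident n i).aemeasurable_fst) hB (fun i _ => ?_) hδ
    refine Eq.trans ?_ (measureReal_conditional_cdf_le hκ hcont hs)
    exact congrArg ENNReal.toReal ((hD_ident n i).measure_mem_eq hB)
  have hbad : ∀ n, (I₁ n)ᶜ.Nonempty →
      P {ω | δ ≤ (({i ∈ (I₁ n)ᶜ | δ < supDist (predCDF (Ftilde n) (D n ω) (D n ω i).1)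
        (cdf (κ (D n ω i).1))}).card : ℝ) / (I₁ n)ᶜ.card} ≤ p n / ENNReal.ofReal δ := by
    intro n hn
    refine measure_frequency_ge_le P (I₁ n)ᶜ hn
      (E := fun i ω => δ < supDist (predCDF (Ftilde n) (D n ω) (D n ω i).1)
        (cdf (κ (D n ω i).1))) (fun i hi => ?_) (fun i hi => ?_) hδ
    · exact (measure_lt_supDist_heldOut (hD_indep n) (hD_ident n) (hD_deploy n) _ κ δ hi).1
    · rw [(measure_lt_supDist_heldOut (hD_indep n) (hD_ident n) (hD_deploy n) _ κ δ hi).2]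
      refine measure_mono fun ω hω => ?_
      simp only [Set.mem_ofPred_eq, sub_zero] at hω ⊢
      exact hω.le.trans (le_abs_self _)
  have hr : Tendsto (fun n => ENNReal.ofReal (1 / (4 * δ ^ 2) / (I₁ n)ᶜ.card)) atTop (𝓝 0) := by
    rw [← ENNReal.ofReal_zero]
    exact ENNReal.tendsto_ofReal
      (((tendsto_natCast_atTop_atTop (R := ℝ)).comp hn₂).const_div_atTop _)
  have hbound : Tendsto (fun n => p n / ENNReal.ofReal δ +
      (ENNReal.ofReal (1 / (4 * δ ^ 2) / (I₁ n)ᶜ.card) +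
        ENNReal.ofReal (1 / (4 * δ ^ 2) / (I₁ n)ᶜ.card))) atTop (𝓝 0) := by
    have h1 : Tendsto (fun n => p n / ENNReal.ofReal δ) atTop (𝓝 0) := by
      simpa using ENNReal.Tendsto.div_const hp0
        (b := ENNReal.ofReal δ) (Or.inr (by simpa using hδ))
    simpa using h1.add (hr.add hr)
  refine tendsto_of_tendsto_of_tendsto_of_le_of_le' tendsto_const_nhds hbound
    (Eventually.of_forall fun _ => zero_le) ?_
  filter_upwards [hn₂.eventually_ge_atTop 1, ((tendsto_natCast_atTop_atTop (R := ℝ)).comp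
    hn₂).eventually_ge_atTop (1 / δ)] with n hn1 hn
  have hne : (I₁ n)ᶜ.Nonempty := Finset.card_pos.1 hn1
  have hn' : 1 ≤ δ * (I₁ n)ᶜ.card := by
    rw [Function.comp_apply, div_le_iff₀ hδ] at hn
    linarith
  -- Budget for `4 * δ`: moving between the levels `3 * δ` and `4 * δ` pays for the PIT error; the
  -- other `3 * δ` cover the frequency deviation, the bad fraction and the slack `η = δ`.
  refine le_trans ?_ (add_le_add (hbad n hne) (add_le_add
    (hfreq n hne (1 - α - 3 * δ) ⟨by linarith, by linarith [hα.1]⟩)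
    (hfreq n hne (1 - α + 3 * δ) ⟨by linarith, by linarith⟩)))
  refine le_trans (measure_mono fun ω hω => ?_)
    ((measure_union_le _ _).trans (by gcongr; exact measure_union_le _ _))
  by_contra hcon
  simp only [Set.mem_union, Set.mem_ofPred_eq, not_or, not_le] at hcon
  obtain ⟨h1, h2, h3⟩ := hcon
  rw [abs_lt] at h2 h3
  have hclose : ∀ i, |pit g L (Ftilde n) (D n ω) i - G (D n ω i)| ≤
      supDist (predCDF (Ftilde n) (D n ω) (D n ω i).1) (cdf (κ (D n ω i).1)) := fun i =>
    abs_cdf_sub_le_supDist _ _ _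
  have hlow := empCDF_le_add (I₁ n)ᶜ (W := pit g L (Ftilde n) (D n ω))
    (V := fun i => G (D n ω i)) (a := 1 - α - 4 * δ) (b := 1 - α - 3 * δ)
    (B := fun i => δ < supDist (predCDF (Ftilde n) (D n ω) (D n ω i).1) (cdf (κ (D n ω i).1)))
    (fun i _ hi => by
      rw [or_iff_not_imp_right, not_lt]
      intro hle
      linarith [(abs_le.1 ((hclose i).trans hle)).1])
  have hupp := empCDF_le_add (I₁ n)ᶜ (W := fun i => G (D n ω i))
    (V := pit g L (Ftilde n) (D n ω)) (a := 1 - α + 3 * δ) (b := 1 - α + 4 * δ)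
    (B := fun i => δ < supDist (predCDF (Ftilde n) (D n ω) (D n ω i).1) (cdf (κ (D n ω i).1)))
    (fun i _ hi => by
      rw [or_iff_not_imp_right, not_lt]
      intro hle
      linarith [(abs_le.1 ((hclose i).trans hle)).2])
  exact hω (calibratedLevel_mem_Icc c _ _ hα hn' hn1 (by linarith) (by linarith))

/-- The calibrated bound lies between two points at which the true conditional CDF brackets
`1 - α`. -/
theorem tendsto_measure_upperBound_notMem {P : Measure Ω} {g : 𝒳 → 𝒜} {L : 𝒜 → 𝒴 → ℝ}
    {D : (n : ℕ) → Ω → Fin n → 𝒳 × 𝒴} {I₁ : (n : ℕ) → Finset (Fin n)}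
    {Ftilde : (n : ℕ) → Kernel ((I₁ n → 𝒳 × 𝒴) × 𝒳) ℝ}
    {κ : Kernel 𝒳 ℝ} {α : ℝ} (hα : α ∈ Set.Ioo (0 : ℝ) 1) {x : 𝒳} {c : QuantileConvention}
    (hlevel : ∀ δ : ℝ, 0 < δ → 4 * δ < α → 4 * δ < 1 - α →
      Tendsto (fun n => P {ω | calibratedLevel c (I₁ n)ᶜ (pit g L (Ftilde n) (D n ω)) α ∉
        Set.Icc (1 - α - 4 * δ) (1 - α + 4 * δ)}) atTop (𝓝 0))
    (hA2 : TendstoInMeasure P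
      (fun n ω => supDist (predCDF (Ftilde n) (D n ω) x) (cdf (κ x))) atTop (fun _ => 0))
    {a b : ℝ} (ha : cdf (κ x) a < 1 - α) (hb : 1 - α < cdf (κ x) b) :
    Tendsto (fun n => P {ω | ¬ ((a : EReal) ≤ upperBound c g L α (Ftilde n) (D n ω) x ∧
      upperBound c g L α (Ftilde n) (D n ω) x ≤ (b : EReal))}) atTop (𝓝 0) := by
  -- `5 * δ` is `4 * δ` for the calibrated level plus `δ` for the fitted CDF at `x`.
  obtain ⟨δ, hδ, h⟩ : ∃ δ : ℝ, 0 < δ ∧ 4 * δ < α ∧ 4 * δ < 1 - α ∧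
      5 * δ < 1 - α - cdf (κ x) a ∧ 5 * δ < cdf (κ x) b - (1 - α) := by
    have : 0 < min (min α (1 - α)) (min (1 - α - cdf (κ x) a) (cdf (κ x) b - (1 - α))) := by
      simp only [lt_min_iff, sub_pos]
      exact ⟨hα, ha, hb⟩
    obtain ⟨δ, hδ, hlt⟩ := exists_between this
    simp only [lt_min_iff] at hlt
    exact ⟨δ / 5, by linarith, by linarith, by linarith, by linarith, by linarith⟩
  obtain ⟨h1, h2, h3, h4⟩ := h
  have hsum := (hlevel δ hδ h1 h2).add ((tendstoInMeasure_iff_norm.1 hA2) δ hδ)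
  rw [add_zero] at hsum
  refine tendsto_of_tendsto_of_tendsto_of_le_of_le tendsto_const_nhds hsum
    (fun _ => zero_le) fun n => ?_
  refine le_trans (measure_mono fun ω hω => ?_) (measure_union_le _ _)
  by_contra hcon
  simp only [Set.mem_union, Set.mem_ofPred_eq, not_or, not_not, not_le, sub_zero] at hcon
  obtain ⟨ht, hd⟩ := hcon
  have hF : ∀ z, |predCDF (Ftilde n) (D n ω) x z - cdf (κ x) z| < δ := fun z =>
    (abs_cdf_sub_le_supDist _ _ z).trans_lt ((le_abs_self _).trans_lt hd)
  have hFa : predCDF (Ftilde n) (D n ω) x a <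
      calibratedLevel c (I₁ n)ᶜ (pit g L (Ftilde n) (D n ω)) α := by
    linarith [ht.1, (abs_lt.1 (hF a)).2]
  have hFb : calibratedLevel c (I₁ n)ᶜ (pit g L (Ftilde n) (D n ω)) α ≤
      predCDF (Ftilde n) (D n ω) x b := by
    linarith [ht.2, (abs_lt.1 (hF b)).1]
  exact hω ⟨le_genInv (monotone_cdf _) hFa, genInv_le hFb⟩

end Calibration

end LossCalibration

/-! ### Conditional coverage and convergence of the bound -/

theorem theorem3
    {Ω 𝒳 𝒴 𝒜 : Type*} [MeasurableSpace Ω] [MeasurableSpace 𝒳] [MeasurableSpace 𝒴]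
    [MeasurableSpace 𝒜]
    (P : Measure Ω) [IsProbabilityMeasure P]
    -- the deployed predictor, the loss, and the deployment draw `(X, Y)`
    (g : 𝒳 → 𝒜) (hg : Measurable g)
    (L : 𝒜 → 𝒴 → ℝ) (hL : Measurable (Function.uncurry L))
    (X : Ω → 𝒳) (hX : Measurable X) (Y : Ω → 𝒴) (hY : Measurable Y)
    -- the calibration sample of size `n`: i.i.d. copies of `(X, Y)`, independent of `(X, Y)`
    (D : (n : ℕ) → Ω → Fin n → 𝒳 × 𝒴)
    (hD_indep : ∀ n, iIndepFun (fun (i : Fin n) (ω : Ω) => D n ω i) P)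
    (hD_ident : ∀ n (i : Fin n), IdentDistrib (fun ω => D n ω i) (fun ω => (X ω, Y ω)) P P)
    (hD_deploy : ∀ n, IndepFun (fun ω => (X ω, Y ω)) (D n) P)
    -- the split into `D₁` and `D₂`
    (I₁ : (n : ℕ) → Finset (Fin n))
    (hn₁ : Tendsto (fun n => (I₁ n).card) atTop atTop)
    (hn₂ : Tendsto (fun n => (I₁ n)ᶜ.card) atTop atTop)
    -- the rule that fits the predictive CDF on `D₁`
    (Ftilde : (n : ℕ) → Kernel ((I₁ n → 𝒳 × 𝒴) × 𝒳) ℝ) [∀ n, IsMarkovKernel (Ftilde n)]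
    -- the conditional law of the loss `Z = L (g X) Y` given `X`
    (κ : Kernel 𝒳 ℝ) [IsMarkovKernel κ]
    (hκ : HasCondDistrib (fun ω => L (g (X ω)) (Y ω)) X κ P)
    (α : ℝ) (hα : α ∈ Set.Ioo (0 : ℝ) 1) (x : 𝒳)
    -- uniform consistency at the random design point `X`
    (hA1 : TendstoInMeasure P
      (fun n ω => LossCalibration.supDist
        (LossCalibration.predCDF (Ftilde n) (D n ω) (X ω)) (cdf (κ (X ω))))
      atTop (fun _ => 0))
    -- uniform consistency at the target `x`
    (hA2 : TendstoInMeasure P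
      (fun n ω => LossCalibration.supDist
        (LossCalibration.predCDF (Ftilde n) (D n ω) x) (cdf (κ x)))
      atTop (fun _ => 0))
    -- regularity of the true conditional law
    (hA3_ae : ∀ᵐ x' ∂(P.map X), Continuous (cdf (κ x')))
    (hA3_x : Continuous (cdf (κ x)))
    (hA3_unique : ∃! q : ℝ, LossCalibration.IsQuantile (κ x) (1 - α) q)
    -- the convention for the empirical quantile
    (c : LossCalibration.QuantileConvention) :
    -- `(x', d) ↦ κ x'` is the conditional law of `Z` given `(X, D) = (x', d)`
    (∀ n, HasCondDistrib (fun ω => L (g (X ω)) (Y ω)) (fun ω => (X ω, D n ω))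
      (κ.prodMkRight (Fin n → 𝒳 × 𝒴)) P) ∧
    -- `P(Z ≤ U_α(x) | X = x, D) → 1 - α` in probability
    TendstoInMeasure P
      (fun n ω => (κ.prodMkRight (Fin n → 𝒳 × 𝒴) (x, D n ω)).real
        {z : ℝ | (z : EReal) ≤ LossCalibration.upperBound c g L α (Ftilde n) (D n ω) x})
      atTop (fun _ => 1 - α) ∧
    -- `U_α(x) → q_{1-α}(x)` in probability
    ∃ q : ℝ, LossCalibration.genInv (cdf (κ x)) (1 - α) = (q : EReal) ∧
      ∀ ε : ℝ, 0 < ε → Tendsto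
        (fun n => P {ω |
          ¬ (((q - ε : ℝ) : EReal) < LossCalibration.upperBound c g L α (Ftilde n) (D n ω) x ∧
            LossCalibration.upperBound c g L α (Ftilde n) (D n ω) x < ((q + ε : ℝ) : EReal))})
        atTop (𝓝 0) := by
  have hbounds : ∀ a b : ℝ, cdf (κ x) a < 1 - α → 1 - α < cdf (κ x) b → Tendsto (fun n =>
      P {ω | ¬ ((a : EReal) ≤ LossCalibration.upperBound c g L α (Ftilde n) (D n ω) x ∧
        LossCalibration.upperBound c g L α (Ftilde n) (D n ω) x ≤ (b : EReal))})
      atTop (𝓝 0) := fun a b ha hb =>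
    LossCalibration.tendsto_measure_upperBound_notMem hα
      (fun δ hδ h1 h2 => LossCalibration.tendsto_measure_calibratedLevel_notMem hg hL hD_indep
        hD_ident hD_deploy hn₂ hκ hα hA1 hA3_ae c hδ h1 h2) hA2 ha hb
  obtain ⟨q, hq, huniq⟩ := hA3_unique
  obtain ⟨hFq, hlt, hgt⟩ := LossCalibration.cdf_lt_and_lt_cdf_of_unique (κ x) hA3_x hq huniq
  refine ⟨fun n => ?_, ?_, q, ?_, fun ε hε => ?_⟩
  · exact LossCalibration.hasCondDistrib_prodMkRight_of_indepFun hκ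
      (aemeasurable_pi_lambda _ fun i => (hD_ident n i).aemeasurable_fst)
      ((hD_deploy n).comp (φ := fun b : 𝒳 × 𝒴 => (b.1, L (g b.1) b.2)) (measurable_fst.prodMk
        (hL.comp ((hg.comp measurable_fst).prodMk measurable_snd))) measurable_id)
  · rw [tendstoInMeasure_iff_norm]
    intro ε hε
    obtain ⟨r, hr, hclose⟩ := Metric.continuousAt_iff.1 (hA3_x.continuousAt (x := q)) ε hε
    have ha := hclose (x := q - r / 2) (by
      rw [Real.dist_eq, abs_lt]; constructor <;> linarith)
    have hb := hclose (x := q + r / 2) (by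
      rw [Real.dist_eq, abs_lt]; constructor <;> linarith)
    rw [hFq, Real.dist_eq, abs_lt] at ha hb
    -- When the bound lies in this bracket, monotonicity traps the coverage between the true CDF's
    -- values at the endpoints, both within `ε` of `1 - α`.
    refine tendsto_of_tendsto_of_tendsto_of_le_of_le tendsto_const_nhds
      (hbounds (q - r / 2) (q + r / 2) (hlt _ (by linarith)) (hgt _ (by linarith)))
      (fun _ => zero_le) fun n => measure_mono fun ω hω => ?_
    rintro ⟨hl, hu⟩
    simp only [Set.mem_ofPred_eq, Kernel.prodMkRight_apply, Real.norm_eq_abs] at hω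
    have h1 : cdf (κ x) (q - r / 2) ≤ (κ x).real
        {z : ℝ | (z : EReal) ≤ LossCalibration.upperBound c g L α (Ftilde n) (D n ω) x} := by
      rw [cdf_eq_real]
      exact measureReal_mono fun z hz => (EReal.coe_le_coe_iff.2 hz).trans hl
    have h2 : (κ x).real
        {z : ℝ | (z : EReal) ≤ LossCalibration.upperBound c g L α (Ftilde n) (D n ω) x} ≤
        cdf (κ x) (q + r / 2) := by
      rw [cdf_eq_real]
      exact measureReal_mono fun z hz => EReal.coe_le_coe_iff.1 (le_trans hz hu)
    refine absurd hω (not_le.2 (abs_lt.2 ⟨?_, ?_⟩)) <;> linarith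
  · refine le_antisymm (LossCalibration.genInv_le hFq.ge) (le_iInf₂ fun z hz => ?_)
    rw [EReal.coe_le_coe_iff]
    by_contra h
    exact absurd (hlt z (not_le.1 h)) (not_lt.2 hz)
  -- Halving `ε` turns the weak bracket into strict inequalities.
  · refine tendsto_of_tendsto_of_tendsto_of_le_of_le tendsto_const_nhds
      (hbounds (q - ε / 2) (q + ε / 2) (hlt _ (by linarith)) (hgt _ (by linarith)))
      (fun _ => zero_le) fun n => measure_mono fun ω hω h => ?_
    refine hω ⟨lt_of_lt_of_le ?_ h.1, lt_of_le_of_lt h.2 ?_⟩ <;>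
    · rw [EReal.coe_lt_coe_iff]
      linarith
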